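/- For a metric space $(E,d)$, a function $f$ with values in $\mathbb{R}$ defined on $E$ and a set $S\subset E$, let $$\operatorname{lip}(f,S)=\inf\{L>0 : |f(x)-f(y)|\le L\,d(x,y)\ \text{ for all } x,y\in S\}\in[0,+\infty]$$ (with $\inf\emptyset=+\infty$), and let $B(x_0,r)$ denote the closed ball with center $x_0$ and radius $r>0$. Let $k\in\mathbb{N}\cup\{\infty\}$ and let $X$ be a real Banach space with the following property: for every Lipschitz function $f:X\to\mathbb{R}$ and every $\eta>0$ there exists a function $g:X\to\mathbb{R}$ of class $C^k(X)$ such that $|f-g|\le\eta$ on $X$ and $$\operatorname{lip}(g,B(x_0,r))\le \operatorname{lip}(f,B(x_0,r+\eta))+\eta$$ for every ball $B(x_0,r)\subset X$. Let $\Omega$ be an open subset of $X$, let $u_0:\overline{\Omega}\to\mathbb{R}$ be a Lipschitz function such that $\operatorname{lip}(u_0,\partial\Omega)<\operatorname{lip}(u_0,\overline{\Omega})$, and let $\varepsilon>0$. Then there exists a function $v:\overline{\Omega}\to\mathbb{R}$ such that $v$ is of class $C^k(\Omega)$, $v$ is Lipschitz on $\overline{\Omega}$ with $\operatorname{lip}(v,\overline{\Omega})\le\operatorname{lip}(u_0,\overline{\Omega})$,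 $v=u_0$ on $\partial\Omega$, and $|u_0-v|\le\varepsilon$ on $\overline{\Omega}$. -/

import Mathlib

open scoped NNReal ENNReal

/-- The Lipschitz constant `lip(f, S)`: the infimum of all real `L > 0` such that
`|f x - f y| ≤ L * dist x y` for all `x, y ∈ S`. It takes values in `[0, ∞]`; the infimum of the
empty set is `∞`, so `lipConst f S = ∞` exactly when `f` is not Lipschitz on `S`. -/
noncomputable def lipConst {E : Type*} [PseudoMetricSpace E] (f : E → ℝ) (S : Set E) : ℝ≥0∞ :=
  ⨅ (L : ℝ) (_ : 0 < L ∧ ∀ x ∈ S, ∀ y ∈ S, |f x - f y| ≤ L * dist x y), ENNReal.ofReal L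

/-!
The function `u₀` is first replaced by one whose Lipschitz constant is strictly below
`K = lip(u₀, closure Ω)` on every ball, and the room gained in this way pays for a smooth gluing.

Let `w` be a Lipschitz extension of `u₀` from `∂Ω` with constant `K₀ = lip(u₀, ∂Ω) < K`. On an
unbounded `Ω`, no function with one constant below `K` need be uniformly close to `u₀`, so a fixed
convex combination of `u₀` and `w` will not do. The function `u = u₀ - δ arctan (u₀ - w)` is close
to `u₀`, agrees with it on `∂Ω`, and formally has gradient `(1 - s) ∇u₀ + s ∇w` with
`s = δ / (1 + (u₀ - w)²)`, which is positive and bounded below on bounded sets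
(`exists_strict_on_balls`).

A gauge `ρ ≤ min (dist (x, Ωᶜ)) (1 / (1 + ‖x‖))` divides `Ω` into bounded dyadic layers. The
hypothesis on `X` supplies smooth cutoffs `χ n` between consecutive layers
(`HasSmoothLipApprox.exists_cutoff`), and then approximations `g n` of `u` that are chosen after the
cutoffs, so close to `u` that the error `lip (χ n) * |g n - g (n + 1)|` of gluing fits into the gap
below `K` on the layer. The glued function `v` is `C^k` in `Ω`, has the bound `K` locally there, and
differs from `u` by at most `ρ`, hence extends continuously by `u` off `Ω`
(`HasSmoothLipApprox.exists_contDiffOn`). The bound `K` becomes global by cutting segments at the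
points where they meet the complement of `Ω` (`LipBound.of_local_of_eqOn_compl`).
-/

open Set Filter Topology

/-! ### Real Lipschitz bounds -/

/-- `L` is a Lipschitz bound for `f` on `S`. The bound is a real number, so that bounds can be
subtracted and compared strictly without casts. -/
def LipBound {E : Type*} [PseudoMetricSpace E] (f : E → ℝ) (S : Set E) (L : ℝ) : Prop :=
  ∀ x ∈ S, ∀ y ∈ S, |f x - f y| ≤ L * dist x y

section LipBound

variable {E : Type*} [PseudoMetricSpace E] {f : E → ℝ} {S T : Set E} {L M : ℝ}

lemma LipBound.mono (h : LipBound f S L) (hTS : T ⊆ S) (hLM : L ≤ M) : LipBound f T M :=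
  fun x hx y hy => (h x (hTS hx) y (hTS hy)).trans (by gcongr)

lemma LipBound.lipschitzOnWith (h : LipBound f S L) (hL : 0 ≤ L) :
    LipschitzOnWith ⟨L, hL⟩ f S :=
  LipschitzOnWith.of_dist_le_mul fun x hx y hy => h x hx y hy

lemma LipBound.continuous (h : LipBound f univ L) (hL : 0 ≤ L) : Continuous f :=
  continuousOn_univ.1 (h.lipschitzOnWith hL).continuousOn

lemma LipschitzOnWith.lipBound {C : ℝ≥0} (h : LipschitzOnWith C f S) : LipBound f S C :=
  fun x hx y hy => h.dist_le_mul x hx y hy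

/-- McShane's extension theorem for real Lipschitz bounds. -/
lemma LipBound.exists_extension (h : LipBound f S L) (hL : 0 ≤ L) :
    ∃ g : E → ℝ, LipBound g univ L ∧ EqOn f g S := by
  obtain ⟨g, hg, hfg⟩ := (h.lipschitzOnWith hL).extend_real
  exact ⟨g, (lipschitzOnWith_univ.2 hg).lipBound, hfg⟩

lemma LipBound.lipConst_le (h : LipBound f S L) (hL : 0 ≤ L) : lipConst f S ≤ ENNReal.ofReal L := by
  -- only positive constants enter the infimum, so `L = 0` is reached as a limit
  have key : ∀ δ : ℝ, 0 < δ → lipConst f S ≤ ENNReal.ofReal (L + δ) := fun δ hδ =>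
    iInf₂_le (L + δ) ⟨by positivity, h.mono Subset.rfl (by linarith)⟩
  have hcont : Tendsto (fun δ : ℝ => ENNReal.ofReal (L + δ)) (𝓝[>] 0) (𝓝 (ENNReal.ofReal L)) := by
    have : Continuous fun δ : ℝ => ENNReal.ofReal (L + δ) :=
      ENNReal.continuous_ofReal.comp (by fun_prop)
    simpa using (this.tendsto 0).mono_left nhdsWithin_le_nhds
  exact ge_of_tendsto hcont (eventually_mem_nhdsWithin.mono key)

lemma lipBound_of_lipConst_le (hL : 0 ≤ L) (h : lipConst f S ≤ ENNReal.ofReal L) :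
    LipBound f S L := by
  intro x hx y hy
  have key : ∀ δ : ℝ, 0 < δ → |f x - f y| ≤ (L + δ) * dist x y := by
    intro δ hδ
    have : lipConst f S < ENNReal.ofReal (L + δ) :=
      h.trans_lt ((ENNReal.ofReal_lt_ofReal_iff (by positivity)).2 (by linarith))
    simp only [lipConst, iInf_lt_iff] at this
    obtain ⟨M, ⟨_, hM⟩, hlt⟩ := this
    have := (ENNReal.ofReal_lt_ofReal_iff (by positivity)).1 hlt
    exact (hM x hx y hy).trans (by gcongr)
  have hcont : Tendsto (fun δ : ℝ => (L + δ) * dist x y) (𝓝[>] 0) (𝓝 (L * dist x y)) := by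
    have : Continuous fun δ : ℝ => (L + δ) * dist x y := by fun_prop
    simpa using (this.tendsto 0).mono_left nhdsWithin_le_nhds
  exact ge_of_tendsto hcont (eventually_mem_nhdsWithin.mono key)

lemma lipBound_toReal (h : lipConst f S ≠ ∞) : LipBound f S (lipConst f S).toReal :=
  lipBound_of_lipConst_le ENNReal.toReal_nonneg (ENNReal.ofReal_toReal h).ge

end LipBound

/-! ### From local to global Lipschitz bounds along segments -/

section Segment

variable {X : Type*} [NormedAddCommGroup X] [NormedSpace ℝ X]

/-- Real functions with a local bound `L` to the right of every point: continuous induction. -/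
lemma abs_sub_le_of_local {h : ℝ → ℝ} {b L : ℝ} (hb : 0 ≤ b) (hc : Continuous h)
    (hloc : ∀ t ∈ Ico 0 b, ∀ᶠ s in 𝓝[>] t, |h s - h t| ≤ L * (s - t)) :
    |h b - h 0| ≤ L * b := by
  have hsub : Icc 0 b ⊆ {t | |h t - h 0| ≤ L * t} := by
    refine IsClosed.Icc_subset_of_forall_exists_gt ?_ (by simp) ?_
    · exact (isClosed_le (by fun_prop) (by fun_prop)).inter isClosed_Icc
    · rintro t ⟨ht, htb⟩ y hy
      have h1 : ∀ᶠ s in 𝓝[>] t, s ∈ Ioc t y := Ioc_mem_nhdsGT hy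
      obtain ⟨s, hs, hsy⟩ := ((hloc t htb).and h1).exists
      refine ⟨s, ?_, hsy⟩
      have := abs_sub_le (h s) (h t) (h 0)
      simp only [mem_ofPred_eq] at ht ⊢
      linarith
  exact hsub ⟨hb, le_rfl⟩

variable {v u : X → ℝ} {Ω : Set X} {K : ℝ}

/-- The half-open segment `[x, x + b (y - x))` lies in `Ω`; the endpoint need not. -/
lemma abs_sub_le_of_segment (hv : Continuous v)
    (hloc : ∀ x ∈ Ω, ∃ U ∈ 𝓝 x, LipBound v U K) {x y : X} {b : ℝ} (hb : 0 ≤ b)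
    (hseg : ∀ t ∈ Ico 0 b, AffineMap.lineMap x y t ∈ Ω) :
    |v (AffineMap.lineMap x y b) - v x| ≤ K * (b * dist x y) := by
  set γ : ℝ → X := fun t => AffineMap.lineMap x y t with hγ
  have hγc : Continuous γ := AffineMap.lineMap_continuous
  have key := abs_sub_le_of_local (h := fun t => v (γ t)) (L := K * dist x y) hb (hv.comp hγc) ?_
  · simpa [hγ, mul_assoc, mul_comm, mul_left_comm] using key
  · intro t ht
    obtain ⟨U, hU, hLip⟩ := hloc _ (hseg t ht)
    have h1 : ∀ᶠ s in 𝓝[>] t, γ s ∈ U := (hγc.continuousAt.mono_left nhdsWithin_le_nhds) hU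
    filter_upwards [h1, self_mem_nhdsWithin] with s hs hst
    have h2 := hLip _ hs _ (mem_of_mem_nhds hU)
    have h3 : dist (γ s) (AffineMap.lineMap x y t) = (s - t) * dist x y := by
      rw [hγ, dist_lineMap_lineMap, Real.dist_eq, abs_of_pos (sub_pos.2 hst)]
    rw [h3] at h2
    calc _ ≤ _ := h2
      _ = _ := by ring

/-- A continuous function that satisfies the bound `K` locally in `Ω` and coincides off `Ω` with a
function of bound `K` satisfies this bound everywhere: cut a segment where it first leaves and
last re-enters `Ω`. -/
lemma LipBound.of_local_of_eqOn_compl (hv : Continuous v)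
    (hloc : ∀ x ∈ Ω, ∃ U ∈ 𝓝 x, LipBound v U K) (hΩ : IsOpen Ω)
    (hu : LipBound u univ K) (huv : ∀ x ∉ Ω, v x = u x) : LipBound v univ K := by
  have hout : ∀ x ∉ Ω, ∀ y ∉ Ω, |v x - v y| ≤ K * dist x y := fun x hx y hy => by
    rw [huv x hx, huv y hy]; exact hu x trivial y trivial
  have hγc : ∀ x y : X, Continuous fun t : ℝ => AffineMap.lineMap x y t :=
    fun x y => AffineMap.lineMap_continuous
  have hmixed : ∀ x, ∀ y ∉ Ω, |v x - v y| ≤ K * dist x y := by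
    intro x y hy
    have hcpt : IsCompact (Icc (0 : ℝ) 1 ∩ {t | AffineMap.lineMap x y t ∉ Ω}) :=
      isCompact_Icc.inter_right (hΩ.isClosed_compl.preimage (hγc x y))
    obtain ⟨b, ⟨hb, hbΩ⟩, hmin⟩ := hcpt.exists_isLeast ⟨1, by simp, by simpa using hy⟩
    have h1 := abs_sub_le_of_segment hv hloc (x := x) (y := y) hb.1 fun t ht => by
      by_contra hcon
      exact absurd (hmin ⟨⟨ht.1, ht.2.le.trans hb.2⟩, hcon⟩) (not_le.2 ht.2)
    have h2 := hout _ hbΩ y hy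
    rw [dist_lineMap_right, Real.norm_eq_abs, abs_of_nonneg (sub_nonneg.2 hb.2)] at h2
    rw [abs_sub_comm] at h1
    have := abs_sub_le (v x) (v (AffineMap.lineMap x y b)) (v y)
    linarith
  intro x _ y _
  by_cases hseg : ∀ t ∈ Ico (0 : ℝ) 1, AffineMap.lineMap x y t ∈ Ω
  · simpa [abs_sub_comm] using abs_sub_le_of_segment hv hloc zero_le_one hseg
  · push Not at hseg
    obtain ⟨t, ht, hp⟩ := hseg
    have h1 := hmixed x _ hp
    have h2 := hmixed y _ hp
    rw [dist_left_lineMap, Real.norm_eq_abs, abs_of_nonneg ht.1] at h1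
    rw [dist_right_lineMap, Real.norm_eq_abs, abs_of_nonneg (sub_nonneg.2 ht.2.le),
      abs_sub_comm] at h2
    have := abs_sub_le (v x) (v (AffineMap.lineMap x y t)) (v y)
    linarith

end Segment

/-! ### Making the Lipschitz bound strict on bounded sets -/

lemma exists_arctan_slope {M : ℝ} (hM : 0 ≤ M) {a b : ℝ} (ha : |a| ≤ M) (hb : |b| ≤ M) :
    ∃ σ ∈ Icc (1 / (1 + M ^ 2)) 1, Real.arctan a - Real.arctan b = σ * (a - b) := by
  have hle : 1 / (1 + M ^ 2) ≤ 1 := div_le_one_of_le₀ (by nlinarith) (by positivity)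
  wlog hab : b < a generalizing a b
  · rcases eq_or_lt_of_le (not_lt.1 hab) with rfl | hlt
    · exact ⟨1, ⟨hle, le_rfl⟩, by simp⟩
    · obtain ⟨σ, hσ, h⟩ := this hb ha hlt
      exact ⟨σ, hσ, by linarith⟩
  obtain ⟨c, hc, h⟩ := exists_deriv_eq_slope Real.arctan hab Real.continuous_arctan.continuousOn
    Real.differentiable_arctan.differentiableOn
  rw [(Real.hasDerivAt_arctan c).deriv, eq_div_iff (by linarith)] at h
  refine ⟨_, ⟨?_, ?_⟩, h.symm⟩
  · have : c ^ 2 ≤ M ^ 2 := sq_le_sq.2 (by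
      rw [abs_of_nonneg hM]
      exact abs_le.2 ⟨by linarith [(abs_le.1 hb).1, hc.1], by linarith [(abs_le.1 ha).2, hc.2]⟩)
    gcongr
  · exact div_le_one_of_le₀ (by nlinarith [sq_nonneg c]) (by positivity)

/-- If `w` has a smaller Lipschitz bound than `u₀`, then `u₀` can be moved slightly towards `w`,
without changing it where `u₀ = w`, so that the bound becomes strict on every ball. A pair of points
sees `u₀ - δ arctan (u₀ - w)` as a convex combination of `u₀` and `w` whose weight on `w` is bounded
below on bounded sets. -/
lemma exists_strict_on_balls {X : Type*} [SeminormedAddCommGroup X] {u₀ w : X → ℝ} {K₀ K ε : ℝ}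
    (hK₀ : 0 ≤ K₀) (hK : K₀ < K) (hu : LipBound u₀ univ K) (hw : LipBound w univ K₀)
    (hε : 0 < ε) :
    ∃ u : X → ℝ, LipBound u univ K ∧
      (∀ R : ℝ, ∃ K' : ℝ, 0 ≤ K' ∧ K' < K ∧ LipBound u (Metric.closedBall 0 R) K') ∧
      (∀ x, u₀ x = w x → u x = u₀ x) ∧ ∀ x, |u₀ x - u x| ≤ ε := by
  obtain ⟨δ, hδ0, hδ1, hδε⟩ : ∃ δ : ℝ, 0 < δ ∧ δ ≤ 1 ∧ δ * 2 ≤ ε :=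
    ⟨min 1 (ε / 2), by positivity, min_le_left _ _, by linarith [min_le_right 1 (ε / 2)]⟩
  set u : X → ℝ := fun x => u₀ x - δ * Real.arctan (u₀ x - w x) with hudef
  have hcomb : ∀ x y : X, ∀ σ c : ℝ, c ≤ σ → σ ≤ 1 → 0 ≤ c →
      Real.arctan (u₀ x - w x) - Real.arctan (u₀ y - w y) = σ * ((u₀ x - w x) - (u₀ y - w y)) →
      |u x - u y| ≤ (K - δ * c * (K - K₀)) * dist x y := by
    intro x y σ c hcσ hσ1 hc h
    have h1 : u x - u y = (1 - δ * σ) * (u₀ x - u₀ y) + δ * σ * (w x - w y) := by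
      simp only [hudef]; linear_combination (-δ) * h
    have hσ0 : 0 ≤ δ * σ := mul_nonneg hδ0.le (hc.trans hcσ)
    have hσ1' : 0 ≤ 1 - δ * σ := by nlinarith
    have h2 := hu x trivial y trivial
    have h3 := hw x trivial y trivial
    have h4 : 0 ≤ δ * (σ - c) * (K - K₀) * dist x y :=
      mul_nonneg (mul_nonneg (mul_nonneg hδ0.le (by linarith)) (by linarith)) dist_nonneg
    calc |u x - u y| ≤ (1 - δ * σ) * |u₀ x - u₀ y| + δ * σ * |w x - w y| := by
          rw [h1]
          refine (abs_add_le _ _).trans ?_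
          rw [abs_mul, abs_mul, abs_of_nonneg hσ0, abs_of_nonneg hσ1']
      _ ≤ (1 - δ * σ) * (K * dist x y) + δ * σ * (K₀ * dist x y) := by gcongr
      _ ≤ _ := by linarith
  refine ⟨u, ?_, ?_, ?_, ?_⟩
  · intro x _ y _
    obtain ⟨σ, hσ, h⟩ := exists_arctan_slope
      (le_max_of_le_left (abs_nonneg (u₀ x - w x))) (le_max_left |u₀ x - w x| |u₀ y - w y|)
      (le_max_right _ _)
    have := hcomb x y σ 0 (le_trans (by positivity) hσ.1) hσ.2 le_rfl h
    simpa using this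
  · intro R
    set M : ℝ := |u₀ 0 - w 0| + (K + K₀) * |R| with hMdef
    have hM0 : 0 ≤ M := by have : 0 ≤ K + K₀ := by linarith
                           positivity
    have hbd : ∀ x ∈ Metric.closedBall (0 : X) R, |u₀ x - w x| ≤ M := by
      intro x hx
      have hx' : dist x 0 ≤ |R| := (Metric.mem_closedBall.1 hx).trans (le_abs_self R)
      have h2 := hu x trivial 0 trivial
      have h3 := hw x trivial 0 trivial
      have h4 : (K + K₀) * dist x 0 ≤ (K + K₀) * |R| :=
        mul_le_mul_of_nonneg_left hx' (by linarith)
      have h5 := neg_abs_le (u₀ 0 - w 0)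
      have h6 := le_abs_self (u₀ 0 - w 0)
      rw [abs_le] at h2 h3 ⊢
      constructor <;> linarith
    have hc : 0 < 1 / (1 + M ^ 2) := by positivity
    have hc1 : 1 / (1 + M ^ 2) ≤ 1 := div_le_one_of_le₀ (by nlinarith) (by positivity)
    refine ⟨K - δ * (1 / (1 + M ^ 2)) * (K - K₀), ?_, ?_, ?_⟩
    · have : δ * (1 / (1 + M ^ 2)) ≤ 1 := mul_le_one₀ hδ1 hc.le hc1
      nlinarith
    · have : 0 < δ * (1 / (1 + M ^ 2)) * (K - K₀) :=
        mul_pos (mul_pos hδ0 hc) (by linarith)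
      linarith
    · intro x hx y hy
      obtain ⟨σ, hσ, h⟩ := exists_arctan_slope hM0 (hbd x hx) (hbd y hy)
      exact hcomb x y σ _ hσ.1 hσ.2 hc.le h
  · intro x hx
    simp [hudef, hx]
  · intro x
    have h1 := Real.arctan_lt_pi_div_two (u₀ x - w x)
    have h2 := Real.neg_pi_div_two_lt_arctan (u₀ x - w x)
    have h3 := Real.pi_le_four
    have h4 : |Real.arctan (u₀ x - w x)| ≤ 2 := abs_le.2 ⟨by linarith, by linarith⟩
    have h5 : u₀ x - u x = δ * Real.arctan (u₀ x - w x) := by simp [hudef]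
    rw [h5, abs_mul, abs_of_pos hδ0]
    exact (mul_le_mul_of_nonneg_left h4 hδ0.le).trans hδε

/-! ### Smooth cutoffs from smooth Lipschitz approximation -/

/-- Lipschitz functions on `X` are uniform limits of `C^k` functions whose Lipschitz bounds on
balls centred at `0` are controlled. -/
def HasSmoothLipApprox (k : ℕ∞) (X : Type*) [NormedAddCommGroup X] [NormedSpace ℝ X] : Prop :=
  ∀ (f : X → ℝ) (C : ℝ), 0 ≤ C → LipBound f univ C → ∀ η : ℝ, 0 < η →
    ∃ g : X → ℝ, ContDiff ℝ k g ∧ (∀ x, |f x - g x| ≤ η) ∧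
      ∀ r L : ℝ, 0 < r → 0 ≤ L → LipBound f (Metric.closedBall 0 (r + η)) L →
        LipBound g (Metric.closedBall 0 r) (L + η)

lemma exists_lipschitzWith_smoothTransition :
    ∃ C : ℝ≥0, LipschitzWith C Real.smoothTransition := by
  obtain ⟨C, hC⟩ := (ContDiff.locallyLipschitz
    (Real.smoothTransition.contDiff (n := 1))).locallyLipschitzOn
    |>.exists_lipschitzOnWith_of_compact (isCompact_Icc (a := (0 : ℝ)) (b := 1))
  refine ⟨C, LipschitzWith.of_dist_le_mul fun x y => ?_⟩
  -- the transition is constant on both sides of `[0, 1]`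
  rw [← Real.smoothTransition.projIcc (x := x), ← Real.smoothTransition.projIcc (x := y)]
  refine (hC.dist_le_mul _ (Subtype.prop _) _ (Subtype.prop _)).trans ?_
  gcongr
  simpa [Subtype.dist_eq] using (LipschitzWith.projIcc (zero_le_one (α := ℝ))).dist_le_mul x y

lemma HasSmoothLipApprox.exists_cutoff {k : ℕ∞} {X : Type*} [NormedAddCommGroup X]
    [NormedSpace ℝ X] (hX : HasSmoothLipApprox k X) {ρ : X → ℝ} (hρ : LipBound ρ univ 1)
    {a b : ℝ} (hab : a < b) :
    ∃ (χ : X → ℝ) (C : ℝ), 0 ≤ C ∧ ContDiff ℝ k χ ∧ LipBound χ univ C ∧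
      (∀ x, χ x ∈ Icc 0 1) ∧ (∀ x, ρ x ≤ a → χ x = 0) ∧ ∀ x, b ≤ ρ x → χ x = 1 := by
  obtain ⟨h, hh, hclose, hlip⟩ := hX ρ 1 zero_le_one hρ ((b - a) / 4) (by linarith)
  obtain ⟨C, hC⟩ := exists_lipschitzWith_smoothTransition
  have hba : 0 < b - a := sub_pos.2 hab
  have hhlip : LipBound h univ (1 + (b - a) / 4) := by
    intro x _ y _
    refine hlip (‖x‖ + ‖y‖ + 1) 1 (by positivity) zero_le_one (hρ.mono (subset_univ _) le_rfl)
      x ?_ y ?_ <;> simp only [mem_closedBall_zero_iff] <;>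
      linarith [norm_nonneg x, norm_nonneg y]
  -- `h` is within `(b - a) / 4` of `ρ`, so the transition is run over the middle half of `[a, b]`
  set s : X → ℝ := fun x => (h x - (a + (b - a) / 4)) * (2 / (b - a)) with hs
  refine ⟨fun x => Real.smoothTransition (s x), C * ((1 + (b - a) / 4) * (2 / (b - a))),
    by positivity, ?_, ?_, ?_, ?_, ?_⟩
  · exact Real.smoothTransition.contDiff.comp ((hh.sub contDiff_const).mul contDiff_const)
  · intro x _ y _
    have h1 : |s x - s y| ≤ (1 + (b - a) / 4) * (2 / (b - a)) * dist x y := by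
      have : s x - s y = (h x - h y) * (2 / (b - a)) := by simp only [hs]; ring
      rw [this, abs_mul, abs_of_pos (a := 2 / (b - a)) (by positivity), mul_right_comm]
      exact mul_le_mul_of_nonneg_right (hhlip x trivial y trivial) (by positivity)
    refine (hC.dist_le_mul (s x) (s y)).trans ?_
    rw [mul_assoc]
    exact mul_le_mul_of_nonneg_left h1 C.2
  · exact fun x => ⟨Real.smoothTransition.nonneg _, Real.smoothTransition.le_one _⟩
  · intro x hx
    refine Real.smoothTransition.zero_of_nonpos (mul_nonpos_of_nonpos_of_nonneg ?_ (by positivity))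
    linarith [(abs_le.1 (hclose x)).1]
  · intro x hx
    refine Real.smoothTransition.one_of_one_le ?_
    have h1 := (abs_le.1 (hclose x)).2
    simp only [hs]
    rw [mul_div_assoc', le_div_iff₀ hba]
    linarith

/-- A bounded gauge whose positivity set is `Ω` and whose superlevel sets are bounded. -/
lemma IsOpen.exists_gauge {X : Type*} [NormedAddCommGroup X] {Ω : Set X} (hΩ : IsOpen Ω) :
    ∃ ρ : X → ℝ, LipBound ρ univ 1 ∧ (∀ x, 0 ≤ ρ x) ∧ (∀ x, ρ x * (1 + ‖x‖) ≤ 1) ∧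
      ∀ x, 0 < ρ x ↔ x ∈ Ω := by
  have hn : LipschitzWith 1 fun x : X => (1 + ‖x‖)⁻¹ := by
    refine LipschitzWith.of_dist_le_mul fun x y => ?_
    have hx := norm_nonneg x
    have hy := norm_nonneg y
    rw [Real.dist_eq, inv_sub_inv (by positivity) (by positivity), abs_div,
      abs_of_pos (a := (1 + ‖x‖) * (1 + ‖y‖)) (by positivity), dist_eq_norm]
    refine (div_le_self (abs_nonneg _) (by nlinarith)).trans ?_
    rw [show 1 + ‖y‖ - (1 + ‖x‖) = -(‖x‖ - ‖y‖) by ring, abs_neg]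
    simpa using abs_norm_sub_norm_le x y
  have hpos : ∀ x : X, 0 < (1 + ‖x‖)⁻¹ := fun x => by positivity
  have hone : ∀ x : X, (1 + ‖x‖)⁻¹ * (1 + ‖x‖) = 1 := fun x =>
    inv_mul_cancel₀ (by positivity)
  have hconv : ∀ {ρ : X → ℝ}, LipschitzWith 1 ρ → LipBound ρ univ 1 := fun h => by
    simpa using (lipschitzOnWith_univ.2 h).lipBound
  rcases eq_empty_or_nonempty Ωᶜ with hempty | hne
  -- here `infDist x Ωᶜ` would be the junk value `0`
  · refine ⟨_, hconv hn, fun x => (hpos x).le, fun x => (hone x).le, fun x => ?_⟩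
    simp [compl_empty_iff.1 hempty, hpos x]
  · refine ⟨fun x => min (Metric.infDist x Ωᶜ) (1 + ‖x‖)⁻¹,
      hconv (by simpa using (Metric.lipschitz_infDist_pt Ωᶜ).min hn),
      fun x => le_min Metric.infDist_nonneg (hpos x).le, fun x => ?_, fun x => ?_⟩
    · exact (mul_le_mul_of_nonneg_right (min_le_right _ _) (by positivity)).trans (hone x).le
    · rw [lt_min_iff, ← hΩ.isClosed_compl.notMem_iff_infDist_pos hne]
      simp [hpos x]

/-! ### Gluing the approximations -/

/-- A convex combination of two functions with bound `L` that differ by at most `D` has bound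
`L + C * D` if the weights have bound `C`. -/
lemma LipBound.convexCombination {E : Type*} [PseudoMetricSpace E] {S : Set E} {χ f g : E → ℝ}
    {L C D : ℝ} (hf : LipBound f S L) (hg : LipBound g S L) (hχ : LipBound χ S C)
    (h01 : ∀ x, χ x ∈ Icc (0 : ℝ) 1) (hC : 0 ≤ C) (hfg : ∀ x, |f x - g x| ≤ D) :
    LipBound (fun x => g x + (1 - χ x) * (f x - g x)) S (L + C * D) := by
  intro x hx y hy
  have h0 := (h01 x).1
  have h1 : 0 ≤ 1 - χ x := sub_nonneg.2 (h01 x).2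
  have hd : g x + (1 - χ x) * (f x - g x) - (g y + (1 - χ y) * (f y - g y)) =
      χ x * (g x - g y) + (1 - χ x) * (f x - f y) - (χ x - χ y) * (f y - g y) := by ring
  have hprod : |(χ x - χ y) * (f y - g y)| ≤ C * dist x y * D := by
    rw [abs_mul]
    exact mul_le_mul (hχ x hx y hy) (hfg y) (abs_nonneg _) (by positivity)
  have hsum : |χ x * (g x - g y) + (1 - χ x) * (f x - f y)| ≤ L * dist x y := by
    refine (abs_add_le _ _).trans ?_
    rw [abs_mul, abs_mul, abs_of_nonneg h0, abs_of_nonneg h1]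
    calc _ ≤ χ x * (L * dist x y) + (1 - χ x) * (L * dist x y) := by
          gcongr
          exacts [hg x hx y hy, hf x hx y hy]
      _ = _ := by ring
  simp only [hd]
  refine (abs_sub _ _).trans ?_
  linarith

/-- If the bound of `u` is strict on every ball, then `u` can be replaced in `Ω` by a `C^k` function
at no cost in the Lipschitz bound. In the dyadic layer number `n` of a gauge of `Ω`, the new
function interpolates between two approximations of `u`; these are so close to `u` that the gap
between the bound on the layer and `K` pays for the slope of the cutoff. -/
lemma HasSmoothLipApprox.exists_contDiffOn {k : ℕ∞} {X : Type*} [NormedAddCommGroup X]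
    [NormedSpace ℝ X] (hX : HasSmoothLipApprox k X) {Ω : Set X} (hΩ : IsOpen Ω) {u : X → ℝ}
    {K ε : ℝ} (hK : 0 ≤ K) (hu : LipBound u univ K)
    (hstrict : ∀ R : ℝ, ∃ K' : ℝ, 0 ≤ K' ∧ K' < K ∧ LipBound u (Metric.closedBall 0 R) K')
    (hε : 0 < ε) :
    ∃ v : X → ℝ, ContDiffOn ℝ k v Ω ∧ LipBound v univ K ∧ (∀ x ∉ Ω, v x = u x) ∧
      ∀ x, |u x - v x| ≤ ε := by
  obtain ⟨ρ, hρ, hρ0, hρn, hρΩ⟩ := hΩ.exists_gauge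
  have hρc : Continuous ρ := hρ.continuous zero_le_one
  have hp : ∀ n : ℕ, (0 : ℝ) < (1 / 2) ^ n := fun n => by positivity
  have hps : ∀ n : ℕ, ((1 : ℝ) / 2) ^ (n + 1) = 1 / 2 * (1 / 2) ^ n := fun n => by ring
  have hpa : ∀ {m n : ℕ}, m ≤ n → ((1 : ℝ) / 2) ^ n ≤ (1 / 2) ^ m := fun h =>
    pow_le_pow_of_le_one (by norm_num) (by norm_num) h
  choose χ C hC0 hχs hχC hχ01 hχ0 hχ1 using fun n : ℕ =>
    hX.exists_cutoff hρ (a := 5 / 8 * (1 / 2) ^ n) (b := 7 / 8 * (1 / 2) ^ n)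
      (by linarith [hp n])
  choose κ hκ0 hκK hκ using fun n : ℕ => hstrict (2 ^ (n + 1) + 1)
  -- `β n` is the accuracy needed in layer `n`, where the approximations `n` and `n + 1` occur
  obtain ⟨β, hβ0, hβ1, hβp, hβε, hβK⟩ : ∃ β : ℕ → ℝ, (∀ n, 0 < β n) ∧ (∀ n, β n ≤ 1) ∧
      (∀ n, β n ≤ (1 / 2) ^ (n + 1)) ∧ (∀ n, β n ≤ ε) ∧
      ∀ n, κ n + β n + C n * (2 * β n) ≤ K := by
    refine ⟨fun n => min (min ((1 / 2) ^ (n + 1)) ε) ((K - κ n) / (1 + 2 * C n)), fun n => ?_,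
      fun n => ?_, fun n => ?_, fun n => ?_, fun n => ?_⟩
    · have h1 := sub_pos.2 (hκK n)
      have h2 := hC0 n
      positivity
    · exact (min_le_left _ _).trans ((min_le_left _ _).trans
        (pow_le_one₀ (by norm_num) (by norm_num)))
    · exact (min_le_left _ _).trans (min_le_left _ _)
    · exact (min_le_left _ _).trans (min_le_right _ _)
    · have h2 := hC0 n
      have := (le_div_iff₀ (by positivity)).1
        (min_le_right (min ((1 / 2) ^ (n + 1)) ε) ((K - κ n) / (1 + 2 * C n)))
      linarith
  choose g hgs hgu hgL using fun n : ℕ =>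
    hX u K hK hu (min (β n) (β (n - 1))) (lt_min (hβ0 _) (hβ0 _))
  have hgu₀ : ∀ n x, |u x - g n x| ≤ β n := fun n x => (hgu n x).trans (min_le_left _ _)
  have hgu₁ : ∀ n x, |u x - g (n + 1) x| ≤ β n := fun n x =>
    (hgu (n + 1) x).trans (min_le_right _ _)
  have hgLip : ∀ m n, min (β m) (β (m - 1)) ≤ β n →
      LipBound (g m) (Metric.closedBall 0 (2 ^ (n + 1))) (κ n + β n) := by
    intro m n hmn
    refine (hgL m (2 ^ (n + 1)) (κ n) (by positivity) (hκ0 n) ((hκ n).mono ?_ le_rfl)).mono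
      Subset.rfl (by linarith)
    exact Metric.closedBall_subset_closedBall (by linarith [hβ1 n])
  -- the interpolation used in layer `n`
  set w : ℕ → X → ℝ := fun n x => g n x + (1 - χ n x) * (g (n + 1) x - g n x) with hw
  set A : ℕ → Set X := fun n => ρ ⁻¹' Ioo ((1 / 2) ^ (n + 1)) (5 / 4 * (1 / 2) ^ n) with hA
  have hAo : ∀ n, IsOpen (A n) := fun n => isOpen_Ioo.preimage hρc
  have hcover : ∀ x ∈ Ω, ∃ n, x ∈ A n ∧ (1 / 2) ^ (n + 1) < ρ x := by
    intro x hx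
    have h1 : ρ x ≤ 1 := by nlinarith [hρn x, hρ0 x, norm_nonneg x]
    obtain ⟨n, hn, hn'⟩ := exists_nat_pow_near_of_lt_one ((hρΩ x).2 hx) h1
      (by norm_num : (0 : ℝ) < 1 / 2) (by norm_num)
    exact ⟨n, ⟨hn, by linarith [hp n]⟩, hn⟩
  have hAball : ∀ n, A n ⊆ Metric.closedBall 0 (2 ^ (n + 1)) := by
    intro n x hx
    rw [mem_closedBall_zero_iff]
    have h1 : ((1 : ℝ) / 2) ^ (n + 1) * (1 + ‖x‖) ≤ 1 :=
      (mul_le_mul_of_nonneg_right hx.1.le (by positivity)).trans (hρn x)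
    rw [one_div, inv_pow, inv_mul_le_iff₀ (by positivity)] at h1
    linarith
  have hwLip : ∀ n, LipBound (w n) (A n) K := by
    intro n
    have hgn := (hgLip n n (min_le_left _ _)).mono (hAball n) le_rfl
    have hgn1 := (hgLip (n + 1) n (min_le_right _ _)).mono (hAball n) le_rfl
    refine (LipBound.convexCombination (D := 2 * β n) hgn1 hgn
      ((hχC n).mono (subset_univ _) le_rfl) (hχ01 n) (hC0 n) fun x => ?_).mono Subset.rfl (hβK n)
    have h1 := abs_le.1 (hgu₀ n x)
    have h2 := abs_le.1 (hgu₁ n x)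
    exact abs_le.2 ⟨by linarith, by linarith⟩
  have hwu : ∀ n x, |u x - w n x| ≤ β n := by
    intro n x
    have h0 := (hχ01 n x).1
    have h1 : 0 ≤ 1 - χ n x := sub_nonneg.2 (hχ01 n x).2
    have hd : u x - w n x = χ n x * (u x - g n x) + (1 - χ n x) * (u x - g (n + 1) x) := by
      simp only [hw]; ring
    rw [hd]
    refine (abs_add_le _ _).trans ?_
    rw [abs_mul, abs_mul, abs_of_nonneg h0, abs_of_nonneg h1]
    calc _ ≤ χ n x * β n + (1 - χ n x) * β n := by
          gcongr
          exacts [hgu₀ n x, hgu₁ n x]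
      _ = _ := by ring
  -- one formula for all layers: in `A n` the cutoffs before `n` vanish, those after `n` equal `1`
  classical
  set v : X → ℝ := fun x =>
    if x ∈ Ω then g 0 x + ∑' m, (1 - χ m x) * (g (m + 1) x - g m x) else u x with hv
  have hAΩ : ∀ n, A n ⊆ Ω := fun n x hx => (hρΩ x).1 ((hp _).trans hx.1)
  have hvw : ∀ n, EqOn v (w n) (A n) := by
    intro n x hx
    have hzero : ∀ m ∉ Finset.range (n + 1), (1 - χ m x) * (g (m + 1) x - g m x) = 0 := by
      intro m hm
      have h1 : χ m x = 1 := hχ1 m x (by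
        have := hpa (show n + 1 ≤ m by simpa using hm)
        linarith [hx.1, hp m])
      rw [h1]; ring
    have hone : ∀ m ∈ Finset.range n, (1 - χ m x) * (g (m + 1) x - g m x) =
        g (m + 1) x - g m x := by
      intro m hm
      have h1 : χ m x = 0 := hχ0 m x (by
        have := hpa (show m + 1 ≤ n by simpa using hm)
        linarith [hx.2, hps m])
      rw [h1]; ring
    simp only [hv, if_pos (hAΩ n hx), hw]
    rw [tsum_eq_sum hzero, Finset.sum_range_succ, Finset.sum_congr rfl hone,
      Finset.sum_range_sub (fun m => g m x)]
    ring
  have hvout : ∀ x ∉ Ω, v x = u x := fun x hx => if_neg hx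
  have hvρ : ∀ x, |u x - v x| ≤ ρ x := by
    intro x
    by_cases hx : x ∈ Ω
    · obtain ⟨n, hn, hlt⟩ := hcover x hx
      rw [hvw n hn]
      exact (hwu n x).trans ((hβp n).trans hlt.le)
    · simpa [hvout x hx] using hρ0 x
  have hvε : ∀ x, |u x - v x| ≤ ε := by
    intro x
    by_cases hx : x ∈ Ω
    · obtain ⟨n, hn, -⟩ := hcover x hx
      rw [hvw n hn]
      exact (hwu n x).trans (hβε n)
    · simpa [hvout x hx] using hε.le
  have hwsmooth : ∀ n, ContDiff ℝ k (w n) := fun n =>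
    (hgs n).add ((contDiff_const.sub (hχs n)).mul ((hgs (n + 1)).sub (hgs n)))
  have hsmooth : ∀ x ∈ Ω, ContDiffAt ℝ k v x := by
    intro x hx
    obtain ⟨n, hn, -⟩ := hcover x hx
    exact (hwsmooth n).contDiffAt.congr_of_eventuallyEq
      ((hvw n).eventuallyEq_of_mem ((hAo n).mem_nhds hn))
  have hvc : Continuous v := by
    refine continuous_iff_continuousAt.2 fun x => ?_
    by_cases hx : x ∈ Ω
    · exact (hsmooth x hx).continuousAt
    · -- `v - u` is squeezed by the gauge, which vanishes off `Ω`
      have hρx : ρ x = 0 := le_antisymm (not_lt.1 fun h => hx ((hρΩ x).1 h)) (hρ0 x)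
      have hdiff : Tendsto (fun y => u y - v y) (𝓝 x) (𝓝 0) :=
        squeeze_zero_norm hvρ (hρx ▸ hρc.continuousAt.tendsto)
      have hlim := ((hu.continuous hK).continuousAt (x := x)).tendsto.sub hdiff
      simpa [ContinuousAt, hvout x hx] using hlim
  refine ⟨v, fun x hx => (hsmooth x hx).contDiffWithinAt, ?_, hvout, hvε⟩
  refine LipBound.of_local_of_eqOn_compl hvc (fun x hx => ?_) hΩ hu hvout
  obtain ⟨n, hn, -⟩ := hcover x hx
  refine ⟨A n, (hAo n).mem_nhds hn, fun y hy z hz => ?_⟩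
  rw [hvw n hy, hvw n hz]
  exact hwLip n y hy z hz

/-! ### Smooth functions with the same boundary values and Lipschitz constant -/

theorem theorem1p3 (k : ℕ∞) (X : Type*) [NormedAddCommGroup X] [NormedSpace ℝ X]
    [CompleteSpace X]
    (hX : ∀ f : X → ℝ, (∃ C : ℝ≥0, LipschitzWith C f) → ∀ η : ℝ, 0 < η →
      ∃ g : X → ℝ, ContDiff ℝ k g ∧ (∀ x, |f x - g x| ≤ η) ∧
        ∀ (x₀ : X) (r : ℝ), 0 < r →
          lipConst g (Metric.closedBall x₀ r) ≤
            lipConst f (Metric.closedBall x₀ (r + η)) + ENNReal.ofReal η)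
    (Ω : Set X) (hΩ : IsOpen Ω) (u₀ : X → ℝ)
    (hu₀ : ∃ C : ℝ≥0, LipschitzOnWith C u₀ (closure Ω))
    (hlt : lipConst u₀ (frontier Ω) < lipConst u₀ (closure Ω))
    (ε : ℝ) (hε : 0 < ε) :
    ∃ v : X → ℝ, ContDiffOn ℝ k v Ω ∧
      (∃ C : ℝ≥0, LipschitzOnWith C v (closure Ω)) ∧
      lipConst v (closure Ω) ≤ lipConst u₀ (closure Ω) ∧
      (∀ x ∈ frontier Ω, v x = u₀ x) ∧
      ∀ x ∈ closure Ω, |u₀ x - v x| ≤ ε := by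
  have hX' : HasSmoothLipApprox k X := by
    intro f C hC hf η hη
    obtain ⟨g, hg, hfg, hlip⟩ := hX f ⟨_, lipschitzOnWith_univ.1 (hf.lipschitzOnWith hC)⟩ η hη
    refine ⟨g, hg, hfg, fun r L hr hL hfL => lipBound_of_lipConst_le (by positivity) ?_⟩
    rw [ENNReal.ofReal_add hL hη.le]
    exact (hlip 0 r hr).trans (add_le_add_left (hfL.lipConst_le hL) _)
  obtain ⟨C, hC⟩ := hu₀
  have htop : lipConst u₀ (closure Ω) ≠ ∞ :=
    ((hC.lipBound.lipConst_le C.2).trans_lt ENNReal.ofReal_lt_top).ne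
  have hK := lipBound_toReal htop
  have hK₀ := lipBound_toReal hlt.ne_top
  have hKlt := (ENNReal.toReal_lt_toReal hlt.ne_top htop).2 hlt
  have hKofReal := ENNReal.ofReal_toReal htop
  set K := (lipConst u₀ (closure Ω)).toReal
  set K₀ := (lipConst u₀ (frontier Ω)).toReal
  have hK₀0 : 0 ≤ K₀ := ENNReal.toReal_nonneg
  have hK0 : 0 ≤ K := ENNReal.toReal_nonneg
  obtain ⟨U, hU, hUu⟩ := hK.exists_extension hK0
  obtain ⟨w, hw, hwu⟩ := hK₀.exists_extension hK₀0
  obtain ⟨u, huK, hstrict, hueq, huε⟩ :=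
    exists_strict_on_balls hK₀0 hKlt hU hw (half_pos hε)
  obtain ⟨v, hv, hvK, hvout, hvε⟩ := hX'.exists_contDiffOn hΩ hK0 huK hstrict (half_pos hε)
  have hvcl : LipBound v (closure Ω) K := hvK.mono (subset_univ _) le_rfl
  refine ⟨v, hv, ⟨_, hvcl.lipschitzOnWith hK0⟩, (hvcl.lipConst_le hK0).trans hKofReal.le, ?_, ?_⟩
  · intro x hx
    have hxΩ : x ∉ Ω := fun h => (hΩ.frontier_eq ▸ hx).2 h
    have hUx : U x = u₀ x := (hUu (frontier_subset_closure hx)).symm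
    rw [hvout x hxΩ, hueq x (hUx.trans (hwu hx)), hUx]
  · intro x hx
    rw [hUu hx]
    have := abs_sub_le (U x) (u x) (v x)
    linarith [huε x, hvε x]
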